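/- \textbf{Proposition.} For a continuous function $x:[0,1]\to\mathbb R$ with $x(0)=x(1)=0$, $p\ge 1$, $n\in\mathbb N=\{1,2,\dots\}$, $m\in\mathbb N_0$ and $0\le k\le 2^m-1$, let $$V_n^{(p)}=\sum_{k=0}^{2^n-1}\bigl|x((k+1)2^{-n})-x(k2^{-n})\bigr|^p,\qquad \theta_{m,k}=2^{m/2}\Bigl(2x\Bigl(\tfrac{2k+1}{2^{m+1}}\Bigr)-x\Bigl(\tfrac{k}{2^m}\Bigr)-x\Bigl(\tfrac{k+1}{2^m}\Bigr)\Bigr),\qquad s_n=\Bigl(\sum_{m=0}^{n-1}\sum_{k=0}^{2^m-1}\theta_{m,k}^2\Bigr)^{1/2}.$$ Let $(U_k)_{k\ge1}$ be an i.i.d. sequence of $\{0,1\}$-valued random variables with $\mathbb P(U_k=1)=\tfrac12$ on some probability space, and put $R_m=\sum_{k=1}^m2^{-k}U_k$ (so $R_0=0$) and $S_m=2^m\theta_{m,2^mR_m}^2$. For every $p\ge1$ there are constants $0<A_p\le B_p<\infty$, depending only on $p$ (neither on $x$, nor on $n$, nor on the probability space), such that for all such $x$ and all $n\in\mathbb N$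 $$V_n^{(p)}\le B_p\,2^{n(1-p)}\,\mathbb E\Bigl[\Bigl(\sum_{m=0}^{n-1}S_m\Bigr)^{p/2}\Bigr],$$ and, if $p>1$, also $$A_p\,2^{n(1-p)}\,\mathbb E\Bigl[\Bigl(\sum_{m=0}^{n-1}S_m\Bigr)^{p/2}\Bigr]\le V_n^{(p)}.$$ Moreover, for $p=2$, $V_n^{(2)}=2^{-n}s_n^2$ for all such $x$ and all $n\in\mathbb N$. -/

import Mathlib

open MeasureTheory ProbabilityTheory

noncomputable section

/-- The `p`-th variation of `x` along the `n`-th dyadic partition of `[0,1]`. -/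
def dyadicVariation (x : ℝ → ℝ) (p : ℝ) (n : ℕ) : ℝ :=
  ∑ k ∈ Finset.range (2 ^ n),
    |x (((k : ℝ) + 1) / 2 ^ n) - x ((k : ℝ) / 2 ^ n)| ^ p

/-- The Faber-Schauder coefficient `θ_{m,k}` of `x`. -/
def faberSchauderCoeff (x : ℝ → ℝ) (m k : ℕ) : ℝ :=
  (2 : ℝ) ^ ((m : ℝ) / 2) *
    (2 * x ((2 * (k : ℝ) + 1) / 2 ^ (m + 1)) - x ((k : ℝ) / 2 ^ m) - x (((k : ℝ) + 1) / 2 ^ m))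

/-- The quantity `s_n`, the Euclidean norm of the coefficients of the generations `m < n`. -/
def gladyshevNorm (x : ℝ → ℝ) (n : ℕ) : ℝ :=
  Real.sqrt (∑ m ∈ Finset.range n, ∑ k ∈ Finset.range (2 ^ m), faberSchauderCoeff x m k ^ 2)

/-- An i.i.d. sequence of symmetric Bernoulli variables with values in `{0, 1}`. The sequence is
indexed from `0`: the `j`-th term of the Lean sequence is `U_{j+1}`. -/
structure IsFairBitSequence {Ω : Type*} [MeasurableSpace Ω] (P : Measure Ω)
    (U : ℕ → Ω → Fin 2) : Prop where
  measurable : ∀ j, Measurable (U j)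
  indep : iIndepFun U P
  prob_one : ∀ j, P {ω | U j ω = 1} = 1 / 2

/-- The random dyadic point `R_m = ∑_{k=1}^m 2^{-k} U_k`. -/
def dyadicPoint {Ω : Type*} (U : ℕ → Ω → Fin 2) (m : ℕ) (ω : Ω) : ℝ :=
  ∑ j ∈ Finset.range m, ((U j ω : ℕ) : ℝ) / 2 ^ (j + 1)

/-- `S_m = 2^m θ_{m, 2^m R_m}^2`. The floor only converts the number `2^m R_m`, which is a
nonnegative integer (see `natFloor_dyadicPoint`), into an element of `ℕ`. -/
def squareTerm {Ω : Type*} (x : ℝ → ℝ) (U : ℕ → Ω → Fin 2) (m : ℕ) (ω : Ω) : ℝ :=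
  2 ^ m * faberSchauderCoeff x m ⌊2 ^ m * dyadicPoint U m ω⌋₊ ^ 2

theorem natFloor_dyadicPoint {Ω : Type*} (U : ℕ → Ω → Fin 2) (m : ℕ) (ω : Ω) :
    ((⌊2 ^ m * dyadicPoint U m ω⌋₊ : ℕ) : ℝ) = 2 ^ m * dyadicPoint U m ω := by
  have h : ∃ k : ℕ, 2 ^ m * dyadicPoint U m ω = (k : ℝ) := by
    refine ⟨∑ j ∈ Finset.range m, (U j ω : ℕ) * 2 ^ (m - (j + 1)), ?_⟩
    unfold dyadicPoint
    push_cast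
    rw [Finset.mul_sum]
    refine Finset.sum_congr rfl fun j hj => ?_
    have hj' : j + 1 ≤ m := Finset.mem_range.mp hj
    have h2 : (2 : ℝ) ^ m = 2 ^ (m - (j + 1)) * 2 ^ (j + 1) := by
      rw [← pow_add, Nat.sub_add_cancel hj']
    rw [h2]
    field_simp
  obtain ⟨k, hk⟩ := h
  rw [hk, Nat.floor_natCast]

end

/-! The slopes of `x` on the dyadic intervals containing a uniformly chosen point form a martingale:
passing to one of the two halves of an interval adds or subtracts the jump `2^{m/2} θ_{m,k}`. Hence
`∑_{m<n} S_m` is the bracket of this martingale, and the proposition is the Burkholder inequality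
between the `p`-th moment of a martingale and the `p/2`-th moment of its bracket. For martingales of
this dyadic type, it follows from explicit functions of position and bracket whose mean cannot
increase in a single step `a ↦ a ± d`. There is one such function for each of the two bounds and for
each of the ranges `p ≤ 2` and `2 ≤ p`. -/

open scoped BigOperators

section ConcaveAndConvexPowers

variable {q : ℝ}

lemma add_le_add_of_concaveOn_of_mem_segment {E : Type*} [AddCommGroup E] [Module ℝ E]
    {S : Set E} {f : E → ℝ} (hf : ConcaveOn ℝ S f) {a b c d : E} (ha : a ∈ S) (hd : d ∈ S)
    (hb : b ∈ segment ℝ a d) (hbc : b + c = a + d) : f a + f d ≤ f b + f c := by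
  obtain ⟨α, β, hα, hβ, hαβ, rfl⟩ := hb
  obtain rfl : c = β • a + α • d := by
    obtain rfl : β = 1 - α := by linarith
    rw [eq_sub_of_add_eq' hbc]
    module
  have hfb := hf.2 ha hd hα hβ hαβ
  have hfc := hf.2 ha hd hβ hα (by linarith)
  simp only [smul_eq_mul] at hfb hfc
  calc f a + f d = (α + β) * (f a + f d) := by rw [hαβ, one_mul]
    _ ≤ _ := by linarith

lemma rpow_add_rpow_le_two_mul_rpow {a b c : ℝ} (hq0 : 0 ≤ q) (hq1 : q ≤ 1) (ha : 0 ≤ a)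
    (hb : 0 ≤ b) (hc : a + b = 2 * c) : a ^ q + b ^ q ≤ 2 * c ^ q := by
  have hmem : c ∈ segment ℝ a b := ⟨1 / 2, 1 / 2, by norm_num, by norm_num, by norm_num, by
    simp only [smul_eq_mul]; linarith⟩
  rw [two_mul]
  exact add_le_add_of_concaveOn_of_mem_segment (Real.concaveOn_rpow hq0 hq1) ha hb hmem
    (by linarith)

lemma add_rpow_sub_rpow_le_add_rpow_sub_rpow {a b h : ℝ} (hq0 : 0 ≤ q) (hq1 : q ≤ 1) (hb : 0 ≤ b)
    (hba : b ≤ a) (hh : 0 ≤ h) : (a + h) ^ q - a ^ q ≤ (b + h) ^ q - b ^ q := by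
  have hmem : a ∈ segment ℝ b (a + h) := by
    rw [segment_eq_Icc (by linarith)]
    exact ⟨hba, by linarith⟩
  have := add_le_add_of_concaveOn_of_mem_segment (Real.concaveOn_rpow hq0 hq1) (c := b + h)
    (Set.mem_Ici.2 hb) (Set.mem_Ici.2 (by linarith)) hmem (by ring)
  linarith

lemma mul_rpow_sub_one_self {c : ℝ} (hq : q ≠ 0) (hc : 0 ≤ c) : c * c ^ (q - 1) = c ^ q := by
  rw [← Real.rpow_one_add' hc (by simpa using hq), add_sub_cancel]

lemma rpow_sub_rpow_le_mul_sub {s t : ℝ} (hq : 1 ≤ q) (hs : 0 ≤ s) (ht : 0 ≤ t) :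
    t ^ q - s ^ q ≤ q * t ^ (q - 1) * (t - s) := by
  have hconv := convexOn_rpow hq
  have hderiv := Real.hasDerivAt_rpow_const (x := t) (Or.inr hq)
  rcases lt_trichotomy s t with hst | rfl | hts
  · have h := hconv.slope_le_of_hasDerivAt hs ht hst hderiv
    rwa [slope_def_field, div_le_iff₀ (sub_pos.2 hst)] at h
  · simp
  · have h := hconv.le_slope_of_hasDerivAt ht hs hts hderiv
    rw [slope_def_field, le_div_iff₀ (sub_pos.2 hts)] at h
    linarith

lemma mul_rpow_sub_one_le_rpow_add_rpow {b c : ℝ} (hq : 1 ≤ q) (hb : 0 ≤ b) (hc : 0 ≤ c) :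
    c * b ^ (q - 1) ≤ b ^ q + c ^ q := by
  have hq0 : q ≠ 0 := by linarith
  rcases le_total c b with hcb | hbc
  · calc c * b ^ (q - 1) ≤ b * b ^ (q - 1) := by gcongr
      _ = b ^ q := mul_rpow_sub_one_self hq0 hb
      _ ≤ b ^ q + c ^ q := le_add_of_nonneg_right (Real.rpow_nonneg hc q)
  · calc c * b ^ (q - 1) ≤ c * c ^ (q - 1) := by gcongr
      _ = c ^ q := mul_rpow_sub_one_self hq0 hc
      _ ≤ b ^ q + c ^ q := le_add_of_nonneg_left (Real.rpow_nonneg hb q)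

lemma sub_mul_rpow_sub_one_sub_mul_add_le {u v : ℝ} (hq : 1 ≤ q) (hu : 0 ≤ u) (hv : 0 ≤ v) :
    (u - v) * (u ^ (q - 1) - v ^ (q - 1)) * (u + v)
      ≤ 2 * q * (u - v) ^ 2 * (u ^ (q - 1) + v ^ (q - 1)) := by
  wlog hvu : v ≤ u generalizing u v
  · have := this hv hu (le_of_not_ge hvu)
    linarith
  have hq0 : q ≠ 0 := by linarith
  have hUV : v ^ (q - 1) ≤ u ^ (q - 1) := Real.rpow_le_rpow hv hvu (by linarith)
  have hV : 0 ≤ v ^ (q - 1) := Real.rpow_nonneg hv _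
  have htangent : (u ^ (q - 1) - v ^ (q - 1)) * u ≤ q * u ^ (q - 1) * (u - v) := by
    have h := rpow_sub_rpow_le_mul_sub hq hv hu
    rw [← mul_rpow_sub_one_self hq0 hu, ← mul_rpow_sub_one_self hq0 hv] at h
    linarith [mul_le_mul_of_nonneg_right hvu hV]
  calc (u - v) * (u ^ (q - 1) - v ^ (q - 1)) * (u + v)
      ≤ (u - v) * (u ^ (q - 1) - v ^ (q - 1)) * (u + u) := by
        have := mul_nonneg (sub_nonneg.2 hvu) (sub_nonneg.2 hUV)
        gcongr
    _ = 2 * (u - v) * ((u ^ (q - 1) - v ^ (q - 1)) * u) := by ring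
    _ ≤ 2 * (u - v) * (q * u ^ (q - 1) * (u - v)) := by
        have := sub_nonneg.2 hvu
        gcongr
    _ = 2 * q * (u - v) ^ 2 * u ^ (q - 1) := by ring
    _ ≤ 2 * q * (u - v) ^ 2 * (u ^ (q - 1) + v ^ (q - 1)) := by
        gcongr
        linarith

lemma two_mul_rpow_le_rpow_add_rpow {r u v : ℝ} (hq : 0 ≤ q) (hr : 0 ≤ r) (hu : 0 ≤ u)
    (hv : 0 ≤ v) (hruv : r ^ 2 ≤ u * v) : 2 * r ^ q ≤ u ^ q + v ^ q := by
  have hprod : (r ^ q) ^ 2 ≤ u ^ q * v ^ q := by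
    rw [← Real.mul_rpow hu hv, Real.rpow_pow_comm hr]
    exact Real.rpow_le_rpow (sq_nonneg r) hruv hq
  have := Real.rpow_nonneg hu q
  have := Real.rpow_nonneg hv q
  refine le_of_sq_le_sq ?_ (by positivity)
  nlinarith [sq_nonneg (u ^ q - v ^ q)]

lemma sub_mul_rpow_sub_one_sub_le {c u v : ℝ} (hq : 1 ≤ q) (hu : 0 ≤ u) (hv : 0 ≤ v) (hc : 0 ≤ c)
    (huv : (u - v) ^ 2 ≤ c * (u + v)) :
    (u - v) * (u ^ (q - 1) - v ^ (q - 1)) ≤ 2 * q * c * (u ^ (q - 1) + v ^ (q - 1)) := by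
  have : 0 ≤ u ^ (q - 1) + v ^ (q - 1) :=
    add_nonneg (Real.rpow_nonneg hu _) (Real.rpow_nonneg hv _)
  rcases (add_nonneg hu hv).eq_or_lt with h0 | hpos
  · rw [show u - v = 0 by linarith, zero_mul]
    positivity
  refine le_of_mul_le_mul_right ?_ hpos
  calc (u - v) * (u ^ (q - 1) - v ^ (q - 1)) * (u + v)
      ≤ 2 * q * (u - v) ^ 2 * (u ^ (q - 1) + v ^ (q - 1)) :=
        sub_mul_rpow_sub_one_sub_mul_add_le hq hu hv
    _ ≤ 2 * q * (c * (u + v)) * (u ^ (q - 1) + v ^ (q - 1)) := by gcongr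
    _ = 2 * q * c * (u ^ (q - 1) + v ^ (q - 1)) * (u + v) := by ring

lemma rpow_add_rpow_sub_two_mul_rpow_le {c r u v : ℝ} (hq : 1 ≤ q) (hr : 0 ≤ r) (hu : 0 ≤ u)
    (hv : 0 ≤ v) (hc : 0 ≤ c) (huv : (u - v) ^ 2 ≤ c * (u + v)) :
    u ^ q + v ^ q - 2 * r ^ q
      ≤ q * ((u + v) / 2 - r + q * c) * (u ^ (q - 1) + v ^ (q - 1)) := by
  have htangent_u := rpow_sub_rpow_le_mul_sub hq hr hu
  have htangent_v := rpow_sub_rpow_le_mul_sub hq hr hv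
  have hcross := mul_le_mul_of_nonneg_left (sub_mul_rpow_sub_one_sub_le hq hu hv hc huv)
    (by positivity : 0 ≤ q / 2)
  linarith

end ConcaveAndConvexPowers

section TwoPointInequality

lemma two_mul_mul_sub_sq_mul_le_rpow {p u : ℝ} (hp1 : 1 ≤ p) (hp2 : p ≤ 2) (hu : 0 ≤ u) (l : ℝ) :
    2 * l * u - l ^ 2 * (1 + (2 - p) * (u - 1)) ≤ u ^ p := by
  rcases hu.eq_or_lt with rfl | hu
  · rw [Real.zero_rpow (by linarith)]
    nlinarith [mul_nonneg (sq_nonneg l) (sub_nonneg.2 hp1)]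
  have hw : 0 < u ^ (2 - p) := Real.rpow_pos_of_pos hu _
  have hbernoulli : u ^ (2 - p) ≤ 1 + (2 - p) * (u - 1) := by
    simpa using rpow_one_add_le_one_add_mul_self (s := u - 1) (by linarith)
      (sub_nonneg.2 hp2) (by linarith)
  have hup : u ^ p = u ^ 2 / u ^ (2 - p) := by
    rw [eq_div_iff hw.ne', ← Real.rpow_add hu, add_sub_cancel, Real.rpow_two]
  calc 2 * l * u - l ^ 2 * (1 + (2 - p) * (u - 1))
      ≤ 2 * l * u - l ^ 2 * u ^ (2 - p) := by gcongr
    _ ≤ u ^ 2 / u ^ (2 - p) := by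
        rw [le_div_iff₀ hw]
        linarith [sq_nonneg (u - l * u ^ (2 - p))]
    _ = u ^ p := hup.symm

lemma two_add_le_one_add_rpow_add_one_sub_rpow {p t : ℝ} (hp1 : 1 ≤ p) (hp2 : p ≤ 2)
    (ht : |t| ≤ 1) : 2 + 2 * (p - 1) ^ 2 * t ^ 2 ≤ (1 + t) ^ p + (1 - t) ^ p := by
  obtain ⟨ht0, ht1⟩ := abs_le.1 ht
  -- For `l = 1 ± (p - 1) t` the terms linear in `t` cancel and the `t ^ 2` term is largest.
  have hplus := two_mul_mul_sub_sq_mul_le_rpow hp1 hp2 (by linarith : 0 ≤ 1 + t) (1 + (p - 1) * t)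
  have hminus := two_mul_mul_sub_sq_mul_le_rpow hp1 hp2 (by linarith : 0 ≤ 1 - t) (1 - (p - 1) * t)
  linarith

lemma sq_rpow_eq_abs_rpow (y p : ℝ) : (y ^ 2) ^ (p / 2) = |y| ^ p := by
  rw [← sq_abs, ← Real.rpow_natCast, ← Real.rpow_mul (abs_nonneg y)]
  congr 1
  push_cast
  ring

variable {q : ℝ}

lemma two_mul_rpow_add_sq_le {a d : ℝ} (hq0 : 1 / 2 ≤ q) (hq1 : q ≤ 1) :
    2 * (a ^ 2 + (2 * q - 1) ^ 2 * d ^ 2) ^ q ≤ ((a + d) ^ 2) ^ q + ((a - d) ^ 2) ^ q := by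
  wlog hda : |d| ≤ |a| generalizing a d
  · have had : a ^ 2 ≤ d ^ 2 := sq_le_sq.2 (le_of_not_ge hda)
    have hc : (2 * q - 1) ^ 2 ≤ 1 := by nlinarith
    calc 2 * (a ^ 2 + (2 * q - 1) ^ 2 * d ^ 2) ^ q
        ≤ 2 * (d ^ 2 + (2 * q - 1) ^ 2 * a ^ 2) ^ q := by
          have : a ^ 2 + (2 * q - 1) ^ 2 * d ^ 2 ≤ d ^ 2 + (2 * q - 1) ^ 2 * a ^ 2 := by nlinarith
          gcongr
      _ ≤ ((d + a) ^ 2) ^ q + ((d - a) ^ 2) ^ q := this (le_of_not_ge hda)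
      _ = ((a + d) ^ 2) ^ q + ((a - d) ^ 2) ^ q := by rw [add_comm d, sub_sq_comm d]
  rcases eq_or_ne a 0 with rfl | ha
  · obtain rfl : d = 0 := by simpa using hda
    simp [two_mul]
  obtain ⟨t, rfl⟩ : ∃ t, d = a * t := ⟨d / a, by field_simp⟩
  have ht : |t| ≤ 1 := by
    rw [abs_mul] at hda
    exact (mul_le_iff_le_one_right (abs_pos.2 ha)).1 hda
  obtain ⟨ht0, ht1⟩ := abs_le.1 ht
  have hpow : ∀ u : ℝ, 0 ≤ u → (u ^ 2) ^ q = u ^ (2 * q) := fun u hu => by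
    simpa [abs_of_nonneg hu] using sq_rpow_eq_abs_rpow u (2 * q)
  have hunit : 2 * (1 + (2 * q - 1) ^ 2 * t ^ 2) ^ q
      ≤ ((1 + t) ^ 2) ^ q + ((1 - t) ^ 2) ^ q := by
    have hle : (1 + (2 * q - 1) ^ 2 * t ^ 2) ^ q ≤ 1 + (2 * q - 1) ^ 2 * t ^ 2 :=
      Real.rpow_le_self_of_one_le (le_add_of_nonneg_right (by positivity)) hq1
    have := two_add_le_one_add_rpow_add_one_sub_rpow (p := 2 * q) (by linarith) (by linarith) ht
    rw [hpow _ (by linarith), hpow _ (by linarith)]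
    linarith
  rw [show a ^ 2 + (2 * q - 1) ^ 2 * (a * t) ^ 2 = a ^ 2 * (1 + (2 * q - 1) ^ 2 * t ^ 2) by ring,
    show (a + a * t) ^ 2 = a ^ 2 * (1 + t) ^ 2 by ring,
    show (a - a * t) ^ 2 = a ^ 2 * (1 - t) ^ 2 by ring]
  simp only [Real.mul_rpow, sq_nonneg, show 0 ≤ 1 + (2 * q - 1) ^ 2 * t ^ 2 by positivity]
  linarith [mul_le_mul_of_nonneg_left hunit (Real.rpow_nonneg (sq_nonneg a) q)]

lemma mul_rpow_sub_rpow_le_two_point {a d : ℝ} (hq0 : 1 / 2 ≤ q) (hq1 : q ≤ 1) :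
    (2 * q - 1) ^ 2 * ((a ^ 2 + 2 * d ^ 2) ^ q - (a ^ 2) ^ q)
      ≤ ((a + d) ^ 2) ^ q + ((a - d) ^ 2) ^ q - 2 * (a ^ 2) ^ q := by
  have hconc := (Real.concaveOn_rpow (by linarith) hq1).2
    (Set.mem_Ici.2 (sq_nonneg a)) (Set.mem_Ici.2 (by positivity : 0 ≤ a ^ 2 + 2 * d ^ 2))
    (by nlinarith : 0 ≤ 1 - (2 * q - 1) ^ 2 / 2) (by positivity : 0 ≤ (2 * q - 1) ^ 2 / 2)
    (by ring)
  simp only [smul_eq_mul] at hconc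
  rw [show (1 - (2 * q - 1) ^ 2 / 2) * a ^ 2 + (2 * q - 1) ^ 2 / 2 * (a ^ 2 + 2 * d ^ 2)
    = a ^ 2 + (2 * q - 1) ^ 2 * d ^ 2 by ring] at hconc
  linarith [two_mul_rpow_add_sq_le (a := a) (d := d) hq0 hq1]

end TwoPointInequality

/-- A function of the position and the bracket of a dyadic martingale whose mean does not increase
when the martingale at `a` with bracket `s` moves to `a ± d`, with probability one half each. -/
def IsDyadicSupersolution (f : ℝ → ℝ → ℝ) : Prop :=
  ∀ a s d : ℝ, 0 ≤ s → f (a + d) (s + d ^ 2) + f (a - d) (s + d ^ 2) ≤ 2 * f a s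

section Supersolutions

variable {q : ℝ}

lemma rpow_add_rpow_add_two_mul_rpow_le {a b s d : ℝ} (hq0 : 0 ≤ q) (hq1 : q ≤ 1) (hs : 0 ≤ s)
    (hb : 0 ≤ b) (hbs : b ≤ a ^ 2 + s) :
    ((a + d) ^ 2 + (s + d ^ 2)) ^ q + ((a - d) ^ 2 + (s + d ^ 2)) ^ q + 2 * b ^ q
      ≤ 2 * (a ^ 2 + s) ^ q + 2 * (b + 2 * d ^ 2) ^ q := by
  have hmean := rpow_add_rpow_le_two_mul_rpow hq0 hq1 (c := a ^ 2 + s + 2 * d ^ 2)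
    (by positivity : 0 ≤ (a + d) ^ 2 + (s + d ^ 2))
    (by positivity : 0 ≤ (a - d) ^ 2 + (s + d ^ 2)) (by ring)
  have hincr := add_rpow_sub_rpow_le_add_rpow_sub_rpow hq0 hq1 hb hbs
    (by positivity : 0 ≤ 2 * d ^ 2)
  linarith

theorem isDyadicSupersolution_rpow_sub_bracket (hq0 : 0 ≤ q) (hq1 : q ≤ 1) :
    IsDyadicSupersolution fun a s => (a ^ 2 + s) ^ q - 2 * s ^ q := by
  intro a s d hs
  have hstep := rpow_add_rpow_add_two_mul_rpow_le (d := d) hq0 hq1 hs hs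
    (le_add_of_nonneg_left (sq_nonneg a))
  have hbracket : s ^ q + (s + 2 * d ^ 2) ^ q ≤ 2 * (s + d ^ 2) ^ q :=
    rpow_add_rpow_le_two_mul_rpow hq0 hq1 hs (by positivity) (by ring)
  linarith

theorem isDyadicSupersolution_rpow_sub_sq_rpow (hq0 : 1 / 2 < q) (hq1 : q ≤ 1) :
    IsDyadicSupersolution fun a s => (a ^ 2 + s) ^ q - 2 / (2 * q - 1) ^ 2 * (a ^ 2) ^ q := by
  intro a s d hs
  have hc : 0 < (2 * q - 1) ^ 2 := sq_pos_of_pos (by linarith)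
  have hstep := rpow_add_rpow_add_two_mul_rpow_le (d := d) (by linarith) hq1 hs (sq_nonneg a)
    (le_add_of_nonneg_right hs)
  have hposition := mul_le_mul_of_nonneg_left
    (mul_rpow_sub_rpow_le_two_point (a := a) (d := d) hq0.le hq1)
    (by positivity : 0 ≤ 2 / (2 * q - 1) ^ 2)
  rw [← mul_assoc, div_mul_cancel₀ _ hc.ne'] at hposition
  linarith

theorem isDyadicSupersolution_bracket_rpow_sub (hq : 1 ≤ q) :
    IsDyadicSupersolution fun a s => s ^ q - q * a ^ 2 * s ^ (q - 1) := by
  intro a s d hs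
  have htangent := rpow_sub_rpow_le_mul_sub hq hs (by positivity : 0 ≤ s + d ^ 2)
  have hmono : q * a ^ 2 * s ^ (q - 1) ≤ q * a ^ 2 * (s + d ^ 2) ^ (q - 1) := by
    have := sq_nonneg d
    gcongr
    linarith
  linarith

theorem isDyadicSupersolution_rpow_sub_bracket_mul (hq : 1 ≤ q) :
    IsDyadicSupersolution fun a s =>
      (a ^ 2 + s) ^ q - (2 * q + 8 * q ^ 2) * s * (a ^ 2 + s) ^ (q - 1) := by
  intro a s d hs
  beta_reduce
  set r := a ^ 2 + s with hr
  set u := (a + d) ^ 2 + (s + d ^ 2) with hu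
  set v := (a - d) ^ 2 + (s + d ^ 2) with hv
  have hr0 : 0 ≤ r := by positivity
  have hu0 : 0 ≤ u := by positivity
  have hv0 : 0 ≤ v := by positivity
  have hmean : 2 * r ^ (q - 1) ≤ u ^ (q - 1) + v ^ (q - 1) := by
    refine two_mul_rpow_le_rpow_add_rpow (by linarith) hr0 hu0 hv0 ?_
    have : u * v - r ^ 2 = 4 * d ^ 2 * s + 4 * d ^ 4 := by rw [hu, hv, hr]; ring
    have : 0 ≤ 4 * d ^ 2 * s + 4 * d ^ 4 := by positivity
    linarith
  have hincr : u ^ q + v ^ q - 2 * r ^ q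
      ≤ (2 * q + 8 * q ^ 2) * d ^ 2 * (u ^ (q - 1) + v ^ (q - 1)) := by
    have hsq : (u - v) ^ 2 ≤ 8 * d ^ 2 * (u + v) := by
      have : 8 * d ^ 2 * (u + v) - (u - v) ^ 2 = 16 * d ^ 2 * s + 32 * d ^ 4 := by ring
      have : 0 ≤ 16 * d ^ 2 * s + 32 * d ^ 4 := by positivity
      linarith
    convert rpow_add_rpow_sub_two_mul_rpow_le hq hr0 hu0 hv0 (by positivity) hsq using 2
    ring
  have hmean' := mul_le_mul_of_nonneg_left hmean (by positivity : 0 ≤ (2 * q + 8 * q ^ 2) * s)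
  linarith

end Supersolutions

section DyadicAverages

lemma sum_range_two_mul {M : Type*} [AddCommMonoid M] (f : ℕ → M) (N : ℕ) :
    ∑ k ∈ Finset.range (2 * N), f k = ∑ k ∈ Finset.range N, (f (2 * k) + f (2 * k + 1)) := by
  induction N with
  | zero => simp
  | succ N ih =>
    rw [mul_add_one, Finset.sum_range_succ, Finset.sum_range_succ, ih, Finset.sum_range_succ,
      add_assoc]

lemma expect_range_two_mul {K : Type*} [Semifield K] [CharZero K] (f : ℕ → K) (N : ℕ) :
    𝔼 k ∈ Finset.range (2 * N), f k = 𝔼 k ∈ Finset.range N, (f (2 * k) + f (2 * k + 1)) / 2 := by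
  rw [← Finset.expect_div, Finset.expect_eq_sum_div_card, Finset.expect_eq_sum_div_card,
    sum_range_two_mul, Finset.card_range, Finset.card_range, Nat.cast_mul, Nat.cast_ofNat,
    div_div, mul_comm]

end DyadicAverages

/-- The slope of `x` on the `k`-th dyadic interval of generation `n`. As a function of `n` along
nested intervals, this is the martingale of the proof. -/
noncomputable def dyadicSlope (x : ℝ → ℝ) (n k : ℕ) : ℝ :=
  2 ^ n * (x (((k : ℝ) + 1) / 2 ^ n) - x ((k : ℝ) / 2 ^ n))

/-- The increment of the martingale `dyadicSlope` when passing from the `k`-th dyadic interval of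
generation `n` to its left half; for the right half the increment is the opposite one. -/
noncomputable def dyadicJump (x : ℝ → ℝ) (n k : ℕ) : ℝ :=
  2 ^ n * (2 * x ((2 * (k : ℝ) + 1) / 2 ^ (n + 1)) - x ((k : ℝ) / 2 ^ n)
    - x (((k : ℝ) + 1) / 2 ^ n))

/-- The bracket of the martingale `dyadicSlope`: the sum of its squared increments along the proper
dyadic ancestors of the `k`-th interval of generation `n`. The parent of that interval is the
`k / 2`-th one of generation `n - 1`. -/
noncomputable def dyadicBracket (x : ℝ → ℝ) : ℕ → ℕ → ℝ
  | 0, _ => 0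
  | n + 1, k => dyadicBracket x n (k / 2) + dyadicJump x n (k / 2) ^ 2

section DyadicMartingale

variable (x : ℝ → ℝ) (n k : ℕ)

lemma dyadicBracket_nonneg : 0 ≤ dyadicBracket x n k := by
  induction n generalizing k with
  | zero => exact le_rfl
  | succ n ih => exact add_nonneg (ih _) (sq_nonneg _)

lemma dyadicBracket_left :
    dyadicBracket x (n + 1) (2 * k) = dyadicBracket x n k + dyadicJump x n k ^ 2 := by
  rw [dyadicBracket, Nat.mul_div_cancel_left k two_pos]

lemma dyadicBracket_right :
    dyadicBracket x (n + 1) (2 * k + 1) = dyadicBracket x n k + dyadicJump x n k ^ 2 := by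
  rw [dyadicBracket, show (2 * k + 1) / 2 = k by lia]

lemma dyadicSlope_left :
    dyadicSlope x (n + 1) (2 * k) = dyadicSlope x n k + dyadicJump x n k := by
  have hleft : ((2 * k : ℕ) : ℝ) / 2 ^ (n + 1) = k / 2 ^ n := by
    push_cast
    field
  rw [dyadicSlope, hleft, dyadicSlope, dyadicJump]
  push_cast
  ring

lemma dyadicSlope_right :
    dyadicSlope x (n + 1) (2 * k + 1) = dyadicSlope x n k - dyadicJump x n k := by
  have hright : (((2 * k + 1 : ℕ) : ℝ) + 1) / 2 ^ (n + 1) = ((k : ℝ) + 1) / 2 ^ n := by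
    push_cast
    field
  rw [dyadicSlope, hright, dyadicSlope, dyadicJump]
  push_cast
  ring

lemma dyadicJump_sq : dyadicJump x n k ^ 2 = 2 ^ n * faberSchauderCoeff x n k ^ 2 := by
  have hpow : ((2 : ℝ) ^ ((n : ℝ) / 2)) ^ 2 = 2 ^ n := by
    rw [← Real.rpow_mul_natCast zero_le_two, Nat.cast_ofNat, div_mul_cancel₀ _ two_ne_zero,
      Real.rpow_natCast]
  rw [dyadicJump, faberSchauderCoeff, mul_pow, mul_pow, hpow]
  ring

theorem expect_dyadicSlope_sq :
    𝔼 k ∈ Finset.range (2 ^ n), dyadicSlope x n k ^ 2 = (x 1 - x 0) ^ 2 +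
      ∑ m ∈ Finset.range n, ∑ k ∈ Finset.range (2 ^ m), faberSchauderCoeff x m k ^ 2 := by
  induction n with
  | zero => simp [dyadicSlope]
  | succ n ih =>
    have hstep : ∀ k, (dyadicSlope x (n + 1) (2 * k) ^ 2
        + dyadicSlope x (n + 1) (2 * k + 1) ^ 2) / 2
        = dyadicSlope x n k ^ 2 + 2 ^ n * faberSchauderCoeff x n k ^ 2 := fun k => by
      rw [dyadicSlope_left, dyadicSlope_right, ← dyadicJump_sq]
      ring
    have hcoeff : 𝔼 k ∈ Finset.range (2 ^ n), 2 ^ n * faberSchauderCoeff x n k ^ 2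
        = ∑ k ∈ Finset.range (2 ^ n), faberSchauderCoeff x n k ^ 2 := by
      rw [← Finset.mul_expect]
      simpa using Finset.card_mul_expect (Finset.range (2 ^ n)) (faberSchauderCoeff x n · ^ 2)
    rw [pow_succ', expect_range_two_mul, Finset.expect_congr rfl fun k _ => hstep k,
      Finset.expect_add_distrib, ih, hcoeff, Finset.sum_range_succ, add_assoc]

variable {x} {f g h : ℝ → ℝ → ℝ}

theorem IsDyadicSupersolution.expect_le (hf : IsDyadicSupersolution f) :
    𝔼 k ∈ Finset.range (2 ^ n), f (dyadicSlope x n k) (dyadicBracket x n k)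
      ≤ f (x 1 - x 0) 0 := by
  induction n with
  | zero => simp [dyadicSlope, dyadicBracket]
  | succ n ih =>
    rw [pow_succ', expect_range_two_mul]
    refine (Finset.expect_le_expect fun k _ => ?_).trans ih
    rw [dyadicSlope_left, dyadicSlope_right, dyadicBracket_left, dyadicBracket_right,
      div_le_iff₀' two_pos]
    exact hf _ _ _ (dyadicBracket_nonneg x n k)

lemma IsDyadicSupersolution.expect_le_mul_expect (hf : IsDyadicSupersolution f) (hf0 : f 0 0 = 0)
    {c C : ℝ} (hc : 0 ≤ c) (hgh : ∀ a s, 0 ≤ s → g a s ≤ c * f a s + C * h a s) (hx : x 1 = x 0) :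
    𝔼 k ∈ Finset.range (2 ^ n), g (dyadicSlope x n k) (dyadicBracket x n k)
      ≤ C * 𝔼 k ∈ Finset.range (2 ^ n), h (dyadicSlope x n k) (dyadicBracket x n k) := by
  have hf_le := hf.expect_le (x := x) n
  rw [hx, sub_self, hf0] at hf_le
  refine (Finset.expect_le_expect fun k _ => hgh _ _ (dyadicBracket_nonneg x n k)).trans ?_
  rw [Finset.expect_add_distrib, ← Finset.mul_expect, ← Finset.mul_expect]
  exact add_le_of_nonpos_left (mul_nonpos_of_nonneg_of_nonpos hc hf_le)

end DyadicMartingale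

section Burkholder

variable {q : ℝ}

theorem exists_expect_slope_le_mul_expect_bracket (hq : 0 < q) :
    ∃ C : ℝ, 0 < C ∧ ∀ x : ℝ → ℝ, x 1 = x 0 → ∀ n : ℕ,
      𝔼 k ∈ Finset.range (2 ^ n), (dyadicSlope x n k ^ 2) ^ q
        ≤ C * 𝔼 k ∈ Finset.range (2 ^ n), dyadicBracket x n k ^ q := by
  have hmono : ∀ a s : ℝ, 0 ≤ s → (a ^ 2) ^ q ≤ (a ^ 2 + s) ^ q := fun a s hs => by
    gcongr
    exact le_add_of_nonneg_right hs
  rcases le_total q 1 with hq1 | hq1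
  · refine ⟨2, two_pos, fun x hx n =>
      (isDyadicSupersolution_rpow_sub_bracket hq.le hq1).expect_le_mul_expect n (c := 1)
        (g := fun a _ => (a ^ 2) ^ q) (h := fun _ s => s ^ q) ?_ zero_le_one ?_ hx⟩
    · simp [Real.zero_rpow hq.ne']
    · intro a s hs
      linarith [hmono a s hs]
  · set K := 2 * (2 * q + 8 * q ^ 2)
    refine ⟨K ^ q, by positivity, fun x hx n =>
      (isDyadicSupersolution_rpow_sub_bracket_mul hq1).expect_le_mul_expect n (c := 2)
        (g := fun a _ => (a ^ 2) ^ q) (h := fun _ s => s ^ q) ?_ zero_le_two ?_ hx⟩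
    · simp [Real.zero_rpow hq.ne']
    · intro a s hs
      have habsorb := mul_rpow_sub_one_le_rpow_add_rpow hq1 (by positivity : 0 ≤ a ^ 2 + s)
        (by positivity : 0 ≤ K * s)
      rw [Real.mul_rpow (by positivity) hs] at habsorb
      linarith [hmono a s hs]

theorem exists_mul_expect_bracket_le_expect_slope (hq : 1 / 2 < q) :
    ∃ c : ℝ, 0 < c ∧ ∀ x : ℝ → ℝ, x 1 = x 0 → ∀ n : ℕ,
      c * 𝔼 k ∈ Finset.range (2 ^ n), dyadicBracket x n k ^ q
        ≤ 𝔼 k ∈ Finset.range (2 ^ n), (dyadicSlope x n k ^ 2) ^ q := by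
  suffices ∃ C : ℝ, 0 < C ∧ ∀ x : ℝ → ℝ, x 1 = x 0 → ∀ n : ℕ,
      𝔼 k ∈ Finset.range (2 ^ n), dyadicBracket x n k ^ q
        ≤ C * 𝔼 k ∈ Finset.range (2 ^ n), (dyadicSlope x n k ^ 2) ^ q by
    obtain ⟨C, hC, hle⟩ := this
    exact ⟨C⁻¹, inv_pos.2 hC, fun x hx n => (inv_mul_le_iff₀ hC).2 (hle x hx n)⟩
  have hq0 : 0 < q := by linarith
  rcases le_total q 1 with hq1 | hq1
  · have hc : 0 < 2 * q - 1 := by linarith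
    refine ⟨2 / (2 * q - 1) ^ 2, by positivity, fun x hx n =>
      (isDyadicSupersolution_rpow_sub_sq_rpow hq hq1).expect_le_mul_expect n (c := 1)
        (g := fun _ s => s ^ q) (h := fun a _ => (a ^ 2) ^ q) ?_ zero_le_one ?_ hx⟩
    · simp [Real.zero_rpow hq0.ne']
    · intro a s hs
      have hmono : s ^ q ≤ (a ^ 2 + s) ^ q := by
        gcongr
        exact le_add_of_nonneg_left (sq_nonneg a)
      linarith
  · refine ⟨(2 * q) ^ q, by positivity, fun x hx n =>
      (isDyadicSupersolution_bracket_rpow_sub hq1).expect_le_mul_expect n (c := 2)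
        (g := fun _ s => s ^ q) (h := fun a _ => (a ^ 2) ^ q) ?_ zero_le_two ?_ hx⟩
    · simp [Real.zero_rpow hq0.ne']
    · intro a s hs
      have habsorb := mul_rpow_sub_one_le_rpow_add_rpow hq1 hs
        (by positivity : 0 ≤ 2 * q * a ^ 2)
      rw [Real.mul_rpow (by positivity) (sq_nonneg a)] at habsorb
      linarith

end Burkholder

section Variation

lemma dyadicVariation_eq_mul_expect (x : ℝ → ℝ) (p : ℝ) (n : ℕ) :
    dyadicVariation x p n = (2 : ℝ) ^ ((n : ℝ) * (1 - p)) *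
      𝔼 k ∈ Finset.range (2 ^ n), (dyadicSlope x n k ^ 2) ^ (p / 2) := by
  have hslope : ∀ k, (dyadicSlope x n k ^ 2) ^ (p / 2) = (2 : ℝ) ^ ((n : ℝ) * p) *
      |x (((k : ℝ) + 1) / 2 ^ n) - x ((k : ℝ) / 2 ^ n)| ^ p := fun k => by
    rw [sq_rpow_eq_abs_rpow, dyadicSlope, abs_mul, abs_of_pos (by positivity : (0 : ℝ) < 2 ^ n),
      Real.mul_rpow (by positivity) (abs_nonneg _), Real.rpow_natCast_mul zero_le_two]
  have hpow : (2 : ℝ) ^ ((n : ℝ) * (1 - p)) * (2 : ℝ) ^ ((n : ℝ) * p) = 2 ^ n := by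
    rw [← Real.rpow_add two_pos, ← mul_add, sub_add_cancel, mul_one, Real.rpow_natCast]
  simp_rw [hslope]
  rw [← Finset.mul_expect, ← mul_assoc, hpow, dyadicVariation]
  simpa using (Finset.card_mul_expect (Finset.range (2 ^ n))
    fun k : ℕ => |x (((k : ℝ) + 1) / 2 ^ n) - x ((k : ℝ) / 2 ^ n)| ^ p).symm

lemma gladyshevNorm_sq (x : ℝ → ℝ) (n : ℕ) : gladyshevNorm x n ^ 2 =
    ∑ m ∈ Finset.range n, ∑ k ∈ Finset.range (2 ^ m), faberSchauderCoeff x m k ^ 2 :=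
  Real.sq_sqrt (by positivity)

theorem dyadicVariation_two {x : ℝ → ℝ} (hx : x 1 = x 0) (n : ℕ) :
    dyadicVariation x 2 n = gladyshevNorm x n ^ 2 / 2 ^ n := by
  have hpow : (2 : ℝ) ^ ((n : ℝ) * (1 - 2)) = (2 ^ n)⁻¹ := by
    rw [← Real.rpow_natCast, ← Real.rpow_neg zero_le_two]
    congr 1
    ring
  rw [dyadicVariation_eq_mul_expect, div_self two_ne_zero, hpow, gladyshevNorm_sq]
  simp only [Real.rpow_one]
  rw [expect_dyadicSlope_sq, hx, sub_self, zero_pow two_ne_zero, zero_add, inv_mul_eq_div]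

end Variation

/-- The natural number with the binary digits `v`, the most significant one first. If `v` lists the
first `n` bits of a point of `[0, 1]`, then this is the index of the dyadic interval of generation
`n` that contains the point. -/
def binaryIndex : {n : ℕ} → (Fin n → Fin 2) → ℕ
  | 0, _ => 0
  | _ + 1, v => 2 * binaryIndex (Fin.init v) + v (Fin.last _)

lemma expect_binaryIndex {K : Type*} [Semifield K] [CharZero K] (F : ℕ → K) (n : ℕ) :
    𝔼 v : Fin n → Fin 2, F (binaryIndex v) = 𝔼 k ∈ Finset.range (2 ^ n), F k := by
  suffices ∑ v : Fin n → Fin 2, F (binaryIndex v) = ∑ k ∈ Finset.range (2 ^ n), F k by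
    rw [Fintype.expect_eq_sum_div_card, Finset.expect_eq_sum_div_card, this]
    simp
  induction n generalizing F with
  | zero => simp [binaryIndex]
  | succ n ih =>
    rw [pow_succ', sum_range_two_mul, ← ih fun k => F (2 * k) + F (2 * k + 1),
      ← (Fin.snocEquiv fun _ => Fin 2).sum_comp, Fintype.sum_prod_type_right]
    simp [binaryIndex, Fin.snocEquiv]

section RandomInterval

variable {Ω : Type*}

lemma two_pow_mul_dyadicPoint (U : ℕ → Ω → Fin 2) (n : ℕ) (ω : Ω) :
    2 ^ n * dyadicPoint U n ω = binaryIndex fun i : Fin n => U i ω := by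
  induction n with
  | zero => simp [dyadicPoint, binaryIndex]
  | succ n ih =>
    have hdigit : 2 ^ (n + 1) * dyadicPoint U (n + 1) ω
        = 2 * (2 ^ n * dyadicPoint U n ω) + (U n ω : ℕ) := by
      rw [dyadicPoint, Finset.sum_range_succ, ← dyadicPoint]
      field
    rw [hdigit, ih]
    simp [binaryIndex, Fin.init_def]

lemma sum_squareTerm (x : ℝ → ℝ) (U : ℕ → Ω → Fin 2) (n : ℕ) (ω : Ω) :
    ∑ m ∈ Finset.range n, squareTerm x U m ω
      = dyadicBracket x n (binaryIndex fun i : Fin n => U i ω) := by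
  induction n with
  | zero => simp [dyadicBracket]
  | succ n ih =>
    have hparent : (binaryIndex fun i : Fin (n + 1) => U i ω) / 2
        = binaryIndex fun i : Fin n => U i ω := by
      have : (binaryIndex fun i : Fin (n + 1) => U i ω)
        = 2 * (binaryIndex fun i : Fin n => U i ω) + (U n ω : ℕ) := rfl
      lia
    rw [Finset.sum_range_succ, ih, dyadicBracket, hparent, dyadicJump_sq, squareTerm,
      two_pow_mul_dyadicPoint, Nat.floor_natCast]

variable [MeasurableSpace Ω] {P : Measure Ω} {U : ℕ → Ω → Fin 2}

lemma IsFairBitSequence.map_real_singleton (hU : IsFairBitSequence P U) (j : ℕ) (b : Fin 2) :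
    (P.map (U j)).real {b} = 1 / 2 := by
  have := hU.indep.isProbabilityMeasure
  have := Measure.isProbabilityMeasure_map (μ := P) (hU.measurable j).aemeasurable
  have hone : (P.map (U j)).real {1} = 1 / 2 := by
    rw [map_measureReal_apply (hU.measurable j) (measurableSet_singleton 1), measureReal_def,
      show U j ⁻¹' {1} = {ω | U j ω = 1} from rfl, hU.prob_one]
    simp
  have hsum : (P.map (U j)).real {0} + (P.map (U j)).real {1} = 1 := by
    rw [← Fin.sum_univ_two fun b => (P.map (U j)).real {b}, sum_measureReal_singleton,
      Finset.coe_univ, probReal_univ]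
  fin_cases b
  · exact (eq_sub_of_add_eq hsum).trans (by rw [hone]; norm_num)
  · exact hone

lemma IsFairBitSequence.integral_comp_fin (hU : IsFairBitSequence P U) {n : ℕ}
    (G : (Fin n → Fin 2) → ℝ) : ∫ ω, G (fun i => U i ω) ∂P = 𝔼 v, G v := by
  have := hU.indep.isProbabilityMeasure
  have (j : ℕ) := Measure.isProbabilityMeasure_map (μ := P) (hU.measurable j).aemeasurable
  have hlaw : P.map (fun ω (i : Fin n) => U i ω) = Measure.pi fun i : Fin n => P.map (U i) :=
    (hU.indep.precomp Fin.val_injective).map_fun_eq_pi_map fun i => (hU.measurable i).aemeasurable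
  have hsingleton (v : Fin n → Fin 2) :
      (Measure.pi fun i : Fin n => P.map (U i)).real {v} = (1 / 2) ^ n := by
    rw [measureReal_def, Measure.pi_singleton, ENNReal.toReal_prod]
    simp only [← measureReal_def, hU.map_real_singleton, Finset.prod_const, Finset.card_fin]
  have hmap := integral_map (μ := P) (φ := fun ω (i : Fin n) => U i ω) (f := G)
    (measurable_pi_lambda _ fun i : Fin n => hU.measurable i).aemeasurable
    (measurable_of_finite G).aestronglyMeasurable
  rw [← hmap, hlaw, integral_fintype Integrable.of_finite]
  simp only [hsingleton, smul_eq_mul, ← Finset.mul_sum, Fintype.expect_eq_sum_div_card]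
  simp [div_eq_inv_mul]

theorem IsFairBitSequence.integral_rpow_sum_squareTerm (hU : IsFairBitSequence P U) (x : ℝ → ℝ)
    (q : ℝ) (n : ℕ) : ∫ ω, (∑ m ∈ Finset.range n, squareTerm x U m ω) ^ q ∂P
      = 𝔼 k ∈ Finset.range (2 ^ n), dyadicBracket x n k ^ q := by
  simp only [sum_squareTerm]
  rw [hU.integral_comp_fin fun v => dyadicBracket x n (binaryIndex v) ^ q,
    expect_binaryIndex fun k => dyadicBracket x n k ^ q]

end RandomInterval

theorem mainTheorem2_general :
    (∀ p : ℝ, 0 < p → ∃ A B : ℝ, 0 < A ∧ A ≤ B ∧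
      ∀ (Ω : Type*) [MeasurableSpace Ω] (P : Measure Ω) (U : ℕ → Ω → Fin 2),
        IsFairBitSequence P U → ∀ x : ℝ → ℝ, x 1 = x 0 → ∀ n : ℕ,
        (1 < p →
          A * (2 : ℝ) ^ ((n : ℝ) * (1 - p)) *
            ∫ ω, (∑ m ∈ Finset.range n, squareTerm x U m ω) ^ (p / 2) ∂P
          ≤ dyadicVariation x p n) ∧
        dyadicVariation x p n
          ≤ B * (2 : ℝ) ^ ((n : ℝ) * (1 - p)) *
            ∫ ω, (∑ m ∈ Finset.range n, squareTerm x U m ω) ^ (p / 2) ∂P) ∧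
    (∀ x : ℝ → ℝ, x 1 = x 0 →
      ∀ n : ℕ, dyadicVariation x 2 n = gladyshevNorm x n ^ 2 / 2 ^ n) := by
  refine ⟨fun p hp => ?_, fun x hx n => dyadicVariation_two hx n⟩
  obtain ⟨B, hB, hupper⟩ := exists_expect_slope_le_mul_expect_bracket (half_pos hp)
  obtain ⟨A, hA, hlower⟩ : ∃ A : ℝ, 0 < A ∧ (1 < p → ∀ x : ℝ → ℝ, x 1 = x 0 → ∀ n : ℕ,
      A * 𝔼 k ∈ Finset.range (2 ^ n), dyadicBracket x n k ^ (p / 2)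
        ≤ 𝔼 k ∈ Finset.range (2 ^ n), (dyadicSlope x n k ^ 2) ^ (p / 2)) := by
    by_cases hp1 : 1 < p
    · simpa only [hp1, true_imp_iff] using
        exists_mul_expect_bracket_le_expect_slope (by linarith : 1 / 2 < p / 2)
    · exact ⟨1, one_pos, fun h => absurd h hp1⟩
  refine ⟨min A B, B, lt_min hA hB, min_le_right A B, fun Ω _ P U hU x hx n => ?_⟩
  have hbracket : 0 ≤ 𝔼 k ∈ Finset.range (2 ^ n), dyadicBracket x n k ^ (p / 2) :=
    Finset.expect_nonneg fun k _ => Real.rpow_nonneg (dyadicBracket_nonneg x n k) _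
  rw [hU.integral_rpow_sum_squareTerm, dyadicVariation_eq_mul_expect, mul_right_comm,
    mul_comm _ ((2 : ℝ) ^ _), mul_right_comm B, mul_comm _ ((2 : ℝ) ^ _)]
  refine ⟨fun hp1 => ?_, by gcongr; exact hupper x hx n⟩
  gcongr
  exact (mul_le_mul_of_nonneg_right (min_le_left A B) hbracket).trans (hlower hp1 x hx n)

theorem mainTheorem2 :
    (∀ p : ℝ, 1 ≤ p → ∃ A B : ℝ, 0 < A ∧ A ≤ B ∧
      ∀ (Ω : Type*) [MeasurableSpace Ω] (P : Measure Ω) [IsProbabilityMeasure P]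
        (U : ℕ → Ω → Fin 2), IsFairBitSequence P U →
      ∀ x : ℝ → ℝ, ContinuousOn x (Set.Icc 0 1) → x 0 = 0 → x 1 = 0 →
      ∀ n : ℕ, 1 ≤ n →
        (1 < p →
          A * (2 : ℝ) ^ ((n : ℝ) * (1 - p)) *
            ∫ ω, (∑ m ∈ Finset.range n, squareTerm x U m ω) ^ (p / 2) ∂P
          ≤ dyadicVariation x p n) ∧
        dyadicVariation x p n
          ≤ B * (2 : ℝ) ^ ((n : ℝ) * (1 - p)) *
            ∫ ω, (∑ m ∈ Finset.range n, squareTerm x U m ω) ^ (p / 2) ∂P) ∧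
    (∀ x : ℝ → ℝ, ContinuousOn x (Set.Icc 0 1) → x 0 = 0 → x 1 = 0 →
      ∀ n : ℕ, 1 ≤ n → dyadicVariation x 2 n = gladyshevNorm x n ^ 2 / 2 ^ n) := by
  obtain ⟨hbounds, htwo⟩ := mainTheorem2_general
  refine ⟨fun p hp => ?_, fun x _ h0 h1 n _ => htwo x (h1.trans h0.symm) n⟩
  obtain ⟨A, B, hA, hAB, h⟩ := hbounds p (by linarith)
  exact ⟨A, B, hA, hAB, fun Ω _ P _ U hU x _ h0 h1 n _ => h Ω P U hU x (h1.trans h0.symm) n⟩
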